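/- All graphs are finite, simple and undirected. A *tree-decomposition* of a graph $G$ is a family $(B_x : x\in V(T))$ of subsets of $V(G)$ (bags) indexed by the vertices of a tree $T$, such that for every edge $uv$ of $G$ some bag contains both $u$ and $v$, and for every vertex $v$ of $G$ the set $\{x\in V(T): v\in B_x\}$ induces a non-empty connected subtree of $T$. Its *width* is $\max_x |B_x|-1$, and the *treewidth* of $G$ is the minimum width of a tree-decomposition of $G$. A *monochromatic component* of a (not necessarily proper) vertex-colouring of $G$ is a connected component of the subgraph induced by the vertices of one colour. A colouring has *defect* $d$ if every monochromatic component has maximum degree at most $d$, and *clustering* $m$ if every monochromatic component has at most $m$ vertices. For a class $\mathcal G$ of graphs, the *defective chromatic number* $\chi_\Delta(\mathcal G)$ (respectively the *clustered chromatic number* $\chi_\star(\mathcal G)$) is the minimum integer $c$ for which there is an integer $d$ such that every graph in $\mathcal G$ has a colouring with at most $c$ colours and defect $d$ (respectively clustering $d$). The *chromatic number* of the class is $\chi(\mathcal G)=\max\{\chi(G):G\in\mathcal G\}$. Each of these is $\infty$ if no such number exists. **Theorem.** Let $p\ge 3$ and $k\ge 1$ be integers, and let $\mathcal G$ be the class of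 $K_p$-free graphs of treewidth $k$. Then $\chi_\Delta(\mathcal G)$, $\chi_\star(\mathcal G)$ and $\chi(\mathcal G)$ are finite and $$\chi_\Delta(\mathcal G)=\chi_\star(\mathcal G)=\chi(\mathcal G).$$ This holds both when "of treewidth $k$" means treewidth exactly $k$ and when it means treewidth at most $k$. -/

import Mathlib

/-- A finite simple undirected graph. -/
structure FiniteGraph where
  /-- The vertex set. -/
  V : Type
  /-- The vertex set is finite. -/
  fintypeV : Fintype V
  /-- The adjacency structure. -/
  graph : SimpleGraph V

/-- A tree-decomposition of `G` indexed by the vertices of a tree `T`. -/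
structure TreeDecomposition {V : Type} (G : SimpleGraph V) {ι : Type} (T : SimpleGraph ι) where
  isTree : T.IsTree
  bag : ι → Finset V
  edge_mem : ∀ u v : V, G.Adj u v → ∃ x, u ∈ bag x ∧ v ∈ bag x
  /-- The nodes whose bags contain `v` induce a non-empty connected subtree
  (`SimpleGraph.Connected` includes non-emptiness). -/
  connected : ∀ v : V, (T.induce {x | v ∈ bag x}).Connected

/-- The width of a tree-decomposition: the maximum size of a bag, minus one.  It is an integer,
since the graph with no vertices has a tree-decomposition of width `-1`. -/
def TreeDecomposition.width {V : Type} {G : SimpleGraph V} {ι : Type} [Fintype ι]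
    {T : SimpleGraph ι} (D : TreeDecomposition G T) : ℤ :=
  ((Finset.univ.sup fun x => (D.bag x).card : ℕ) : ℤ) - 1

/-- The treewidth of a graph: the minimum width of a tree-decomposition. -/
noncomputable def treewidth (G : FiniteGraph) : ℤ :=
  sInf {w : ℤ | ∃ (ι : Type) (_ : Fintype ι) (T : SimpleGraph ι)
    (D : TreeDecomposition G.graph T), D.width = w}

/-- The type of monochromatic components of colour `i` for a colouring `f` of `G`: the connected
components of the subgraph of `G` induced by the vertices of colour `i`. -/
abbrev MonoComponent {V : Type} (G : SimpleGraph V) {c : ℕ} (f : V → Fin c) (i : Fin c) : Type :=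
  (G.induce {v | f v = i}).ConnectedComponent

/-- The colouring `f` has defect `d`: every monochromatic component has maximum degree
at most `d`. -/
def HasDefect {V : Type} (G : SimpleGraph V) {c : ℕ} (f : V → Fin c) (d : ℕ) : Prop :=
  ∀ (i : Fin c) (C : MonoComponent G f i), ∀ v, (C.toSimpleGraph.neighborSet v).ncard ≤ d

/-- The colouring `f` has clustering `m`: every monochromatic component has at most
`m` vertices. -/
def HasClustering {V : Type} (G : SimpleGraph V) {c : ℕ} (f : V → Fin c) (m : ℕ) : Prop :=
  ∀ (i : Fin c) (C : MonoComponent G f i), C.supp.ncard ≤ m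

/-- The defective chromatic number of a class of graphs; `⊤` means unbounded. -/
noncomputable def defectiveChromaticNumber (𝒢 : Set FiniteGraph) : ℕ∞ :=
  ⨅ c ∈ {c : ℕ | ∃ d : ℕ, ∀ G ∈ 𝒢, ∃ f : G.V → Fin c, HasDefect G.graph f d}, (c : ℕ∞)

/-- The clustered chromatic number of a class of graphs; `⊤` means unbounded. -/
noncomputable def clusteredChromaticNumber (𝒢 : Set FiniteGraph) : ℕ∞ :=
  ⨅ c ∈ {c : ℕ | ∃ m : ℕ, ∀ G ∈ 𝒢, ∃ f : G.V → Fin c, HasClustering G.graph f m}, (c : ℕ∞)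

/-- The (proper) chromatic number of a class of graphs: the maximum of the chromatic numbers of
its members; `⊤` means unbounded. -/
noncomputable def classChromaticNumber (𝒢 : Set FiniteGraph) : ℕ∞ :=
  ⨆ G ∈ 𝒢, G.graph.chromaticNumber

/-- The class of `K_p`-free graphs of treewidth exactly `k`. -/
def cliqueFreeTreewidthEq (p k : ℕ) : Set FiniteGraph :=
  {G | G.graph.CliqueFree p ∧ treewidth G = k}

/-- The class of `K_p`-free graphs of treewidth at most `k`. -/
def cliqueFreeTreewidthLE (p k : ℕ) : Set FiniteGraph :=
  {G | G.graph.CliqueFree p ∧ treewidth G ≤ k}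

/-!
Every vertex of a tree-decomposition has a topmost bag, and listing the vertices by the depth of
that bag gives an elimination ordering: the predecessors of a vertex in its topmost bag form a
clique of a chordal supergraph. Conversely such an ordering, with fewer than `w` predecessors at
every vertex, is a tree-decomposition with bags of size at most `w`. So treewidth can be read off
elimination orderings, and greedy colouring gives `χ ≤ k + 1` at treewidth `k`.

Clustering bounds defect and a proper colouring has clustering `1`, so only `χ ≤ χ_Δ` is at stake.
Given `G` and `d`, blow up `G` along an elimination ordering: each choice of copies of the vertices
before `v` branches into `N` different copies of `v`. The blow-up maps to `G` and has the same
treewidth. In a colouring of the blow-up with defect `d`, each already chosen neighbour of `v`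
excludes at most `d` of the `N` copies of `v`; for large `N` one can therefore choose copies one
vertex at a time so that they form a properly coloured copy of `G`.
-/

open SimpleGraph

section Trees

variable {ι : Type*} {T : SimpleGraph ι}

theorem isPath_append {x y z : ι} {p : T.Walk x y} {q : T.Walk y z} (hp : p.IsPath)
    (hq : q.IsPath) (h : ∀ u ∈ p.support, u ∈ q.support → u = y) : (p.append q).IsPath := by
  have hqs := hq.support_nodup
  rw [← Walk.cons_tail_support, List.nodup_cons] at hqs
  rw [Walk.isPath_def, Walk.support_append]
  refine hp.support_nodup.append hqs.2 fun u hup huq => hqs.1 ?_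
  exact h u hup (List.mem_of_mem_tail huq) ▸ huq

theorem exists_isPath_support_subset_of_connected_induce {S : Set ι} (hS : (T.induce S).Connected)
    {x y : ι} (hx : x ∈ S) (hy : y ∈ S) :
    ∃ p : T.Walk x y, p.IsPath ∧ ∀ u ∈ p.support, u ∈ S := by
  obtain ⟨p, hp⟩ := hS.exists_isPath ⟨x, hx⟩ ⟨y, hy⟩
  refine ⟨p.map (Embedding.induce S).toHom, hp.map Subtype.val_injective, fun u hu => ?_⟩
  obtain ⟨v, -, rfl⟩ := List.mem_map.mp (Walk.support_map _ p ▸ hu)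
  exact v.2

theorem exists_isPath_dist_lt_of_ne {r t : ι} (h : T.Reachable r t) :
    ∃ p : T.Walk r t, p.IsPath ∧ ∀ u ∈ p.support, u ≠ t → T.dist r u < T.dist r t := by
  classical
  obtain ⟨p, hp, hlength⟩ := h.exists_path_of_dist
  exact ⟨p, hp, fun u hu hut =>
    (T.dist_le (p.takeUntil u hu)).trans_lt (hlength ▸ p.length_takeUntil_lt_length hu hut)⟩

theorem mem_support_and_mem_of_isPath_of_connected_induce (hT : T.IsAcyclic) {S : Set ι}
    (hS : (T.induce S).Connected) {r t x : ι} (ht : t ∈ S)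
    (hmin : ∀ y ∈ S, T.dist r t ≤ T.dist r y) (hx : x ∈ S) {p : T.Walk r x} (hp : p.IsPath) :
    t ∈ p.support ∧ ∀ y ∈ p.support, T.dist r t ≤ T.dist r y → y ∈ S := by
  obtain ⟨s, hs, hsS⟩ := exists_isPath_support_subset_of_connected_induce hS ht hx
  obtain ⟨q, hq, hqlt⟩ := exists_isPath_dist_lt_of_ne (p.reachable.trans s.reachable.symm)
  have hqs : (q.append s).IsPath := isPath_append hq hs fun u huq hus => by
    by_contra hut
    exact (hqlt u huq hut).not_ge (hmin u (hsS u hus))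
  -- Paths in a forest are unique, so `p` runs from `r` to `t` and then inside `S`.
  obtain rfl : p = q.append s :=
    congrArg Subtype.val ((hT.subsingleton_path r x).elim ⟨p, hp⟩ ⟨_, hqs⟩)
  refine ⟨(Walk.mem_support_append_iff _ _).mpr (.inl q.end_mem_support), fun y hy hty => ?_⟩
  rcases (Walk.mem_support_append_iff _ _).mp hy with hyq | hys
  · obtain rfl : y = t := by
      by_contra hyt
      exact (hqlt y hyq hyt).not_ge hty
    exact ht
  · exact hsS y hys

theorem nearest_mem_of_dist_le (hT : T.IsTree) {S S' : Set ι}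
    (hS : (T.induce S).Connected) (hS' : (T.induce S').Connected) {r t t' x : ι}
    (ht : t ∈ S) (hmin : ∀ y ∈ S, T.dist r t ≤ T.dist r y)
    (ht' : t' ∈ S') (hmin' : ∀ y ∈ S', T.dist r t' ≤ T.dist r y)
    (hx : x ∈ S) (hx' : x ∈ S') (htt' : T.dist r t ≤ T.dist r t') : t' ∈ S := by
  obtain ⟨p, hp⟩ := hT.connected.exists_isPath r x
  have ht'p := (mem_support_and_mem_of_isPath_of_connected_induce
    hT.isAcyclic hS' ht' hmin' hx' hp).1
  exact (mem_support_and_mem_of_isPath_of_connected_induce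
    hT.isAcyclic hS ht hmin hx hp).2 t' ht'p htt'

theorem isTree_fromRel_parent [Finite ι] {root : ι} {parent : ι → ι} (rank : ι → ℕ)
    (hroot : parent root = root) (hrank : ∀ x ≠ root, rank (parent x) < rank x) :
    (fromRel fun x y => parent x = y).IsTree := by
  set T := fromRel fun x y => parent x = y
  have adj_parent : ∀ x ≠ root, T.Adj x (parent x) := fun x hx =>
    (fromRel_adj _ _ _).mpr ⟨fun h => (hrank x hx).ne (congrArg rank h.symm), .inl rfl⟩
  have reachable_root : ∀ x, T.Reachable x root := fun x => by
    induction hn : rank x using Nat.strong_induction_on generalizing x with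
    | _ n ih =>
      by_cases hx : x = root
      · exact hx ▸ .rfl
      · exact (adj_parent x hx).reachable.trans (ih _ (hn ▸ hrank x hx) _ rfl)
  have hconn : T.Connected := (connected_iff_exists_forall_reachable _).mpr
    ⟨root, fun x => (reachable_root x).symm⟩
  refine isTree_iff_connected_and_card.mpr ⟨hconn, le_antisymm ?_
    hconn.card_vert_le_card_edgeSet_add_one⟩
  have parentEdge_surjective : Function.Surjective
      fun x : {x // x ≠ root} => (⟨s(x, parent x), adj_parent x x.2⟩ : T.edgeSet) := by
    have hne : ∀ {x y}, T.Adj x y → parent x = y → x ≠ root := by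
      rintro x _ hxy rfl rfl
      exact hxy.ne hroot.symm
    rintro ⟨⟨x, y⟩, hxy : T.Adj x y⟩
    rcases ((fromRel_adj _ _ _).mp hxy).2 with h | h
    · exact ⟨⟨x, hne hxy h⟩, Subtype.ext (congrArg (s(x, ·)) h)⟩
    · exact ⟨⟨y, hne hxy.symm h⟩, Subtype.ext ((congrArg (s(y, ·)) h).trans Sym2.eq_swap)⟩
  calc Nat.card T.edgeSet + 1 ≤ Nat.card {x // x ≠ root} + 1 := by
        gcongr
        exact Nat.card_le_card_of_surjective _ parentEdge_surjective
    _ ≤ Nat.card ι := Finite.card_subtype_lt (x := root) (not_not.mpr rfl)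

end Trees

/-- An elimination ordering of a chordal supergraph of `G`: `pred v` is the set of neighbours of
`v` in the supergraph that precede `v`, and has fewer than `w` elements. The order is encoded by a
rank, and vertices that are not adjacent in the supergraph may have the same rank. -/
structure EliminationScheme {V : Type*} (G : SimpleGraph V) (w : ℕ) where
  rank : V → ℕ
  pred : V → Finset V
  rank_lt_of_mem_pred : ∀ {u v}, u ∈ pred v → rank u < rank v
  card_pred_lt : ∀ v, (pred v).card < w
  mem_pred_or_mem_pred_of_adj : ∀ {u v}, G.Adj u v → u ∈ pred v ∨ v ∈ pred u
  mem_pred_or_mem_pred_of_mem_pred :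
    ∀ {u u' v}, u ∈ pred v → u' ∈ pred v → u ≠ u' → u ∈ pred u' ∨ u' ∈ pred u

theorem exists_injective_monovary {α V : Type*} [LinearOrder α] [Finite V] (f : V → α) :
    ∃ rank : V → ℕ, Function.Injective rank ∧ Monovary f rank := by
  obtain ⟨n, ⟨e⟩⟩ := Finite.exists_equiv_fin V
  let σ := Tuple.sort (f ∘ e.symm)
  refine ⟨fun v => σ.symm (e v), Fin.val_injective.comp (σ.symm.injective.comp e.injective),
    fun u v huv => ?_⟩
  simpa [σ] using Tuple.monotone_sort (f ∘ e.symm) (Fin.le_of_lt huv)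

namespace TreeDecomposition

variable {V : Type} {G : SimpleGraph V} {ι : Type} {T : SimpleGraph ι} (D : TreeDecomposition G T)

/-- A node nearest to the root `r` among the nodes whose bags contain `v`. -/
noncomputable def top (r : ι) (v : V) : ι :=
  Function.argminOn (T.dist r) {x | v ∈ D.bag x} (Set.nonempty_coe_sort.mp (D.connected v).nonempty)

theorem mem_bag_top (r : ι) (v : V) : v ∈ D.bag (D.top r v) :=
  Function.argminOn_mem (T.dist r) {x | v ∈ D.bag x} _

theorem dist_top_le {r x : ι} {v : V} (hv : v ∈ D.bag x) : T.dist r (D.top r v) ≤ T.dist r x :=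
  Function.argminOn_le (T.dist r) {x | v ∈ D.bag x} hv

theorem mem_bag_top_of_dist_le {r x : ι} {u v : V} (hu : u ∈ D.bag x) (hv : v ∈ D.bag x)
    (h : T.dist r (D.top r u) ≤ T.dist r (D.top r v)) : u ∈ D.bag (D.top r v) :=
  nearest_mem_of_dist_le D.isTree (D.connected u) (D.connected v)
    (D.mem_bag_top r u) (fun _ => D.dist_top_le) (D.mem_bag_top r v) (fun _ => D.dist_top_le)
    hu hv h

theorem nonempty_eliminationScheme [Finite V] {w : ℕ} (hw : ∀ x, (D.bag x).card ≤ w) :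
    Nonempty (EliminationScheme G w) := by
  obtain ⟨r⟩ := D.isTree.connected.nonempty
  obtain ⟨rank, rank_injective, dist_monovary⟩ :=
    exists_injective_monovary fun v => T.dist r (D.top r v)
  let pred (v : V) : Finset V := {u ∈ D.bag (D.top r v) | rank u < rank v}
  have mem_pred_or_mem_pred : ∀ {u v x}, u ∈ D.bag x → v ∈ D.bag x → u ≠ v →
      u ∈ pred v ∨ v ∈ pred u := fun hu hv huv =>
    (lt_or_gt_of_ne (rank_injective.ne huv)).imp
      (fun h => Finset.mem_filter.mpr ⟨D.mem_bag_top_of_dist_le hu hv (dist_monovary h), h⟩)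
      (fun h => Finset.mem_filter.mpr ⟨D.mem_bag_top_of_dist_le hv hu (dist_monovary h), h⟩)
  exact ⟨{
    rank := rank
    pred := pred
    rank_lt_of_mem_pred := fun h => (Finset.mem_filter.mp h).2
    card_pred_lt := fun v => (Finset.card_lt_card
      (Finset.filter_ssubset.mpr ⟨v, D.mem_bag_top r v, lt_irrefl (rank v)⟩)).trans_le (hw _)
    mem_pred_or_mem_pred_of_adj := fun {u v} h => by
      obtain ⟨x, hu, hv⟩ := D.edge_mem u v h
      exact mem_pred_or_mem_pred hu hv h.ne
    mem_pred_or_mem_pred_of_mem_pred := fun hu hu' =>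
      mem_pred_or_mem_pred (Finset.mem_filter.mp hu).1 (Finset.mem_filter.mp hu').1 }⟩

end TreeDecomposition

namespace EliminationScheme

section TreeDecomposition

variable {V : Type} {G : SimpleGraph V} {w : ℕ} (E : EliminationScheme G w)

/-- The predecessor of `v` of maximal rank, used as the parent of `v` in a tree-decomposition. -/
noncomputable def parent (v : V) : Option V :=
  (E.pred v).toList.argmax E.rank

variable {E} in
theorem mem_pred_of_mem_parent {p v : V} (h : p ∈ E.parent v) : p ∈ E.pred v :=
  Finset.mem_toList.mp (List.argmax_mem h)

theorem exists_mem_parent_of_mem_pred {u v : V} (hu : u ∈ E.pred v) :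
    ∃ p ∈ E.parent v, u = p ∨ u ∈ E.pred p := by
  have hu' := Finset.mem_toList.mpr hu
  obtain ⟨p, hp⟩ : ∃ p, E.parent v = some p := by
    refine Option.ne_none_iff_exists'.mp fun h => ?_
    simp [List.argmax_eq_none.mp h] at hu'
  refine ⟨p, hp, or_iff_not_imp_left.mpr fun hup => ?_⟩
  refine (E.mem_pred_or_mem_pred_of_mem_pred hu (mem_pred_of_mem_parent hp) hup).resolve_right
    fun hpu => (E.rank_lt_of_mem_pred hpu).not_ge (List.le_of_mem_argmax hu' hp)

/-- The tree joining every vertex to its parent, with `none` as an additional root. -/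
def decompositionTree : SimpleGraph (Option V) :=
  fromRel fun x y => x.bind E.parent = y

theorem decompositionTree_isTree [Finite V] : E.decompositionTree.IsTree := by
  refine isTree_fromRel_parent (root := none) (fun x => x.elim 0 fun v => E.rank v + 1) rfl
    fun x hx => ?_
  obtain ⟨v, rfl⟩ := Option.ne_none_iff_exists'.mp hx
  cases h : E.parent v with
  | none => simp [h]
  | some p => simpa [h] using E.rank_lt_of_mem_pred (mem_pred_of_mem_parent h)

theorem decompositionTree_adj {p v : V} (h : p ∈ E.parent v) :
    E.decompositionTree.Adj (some p) (some v) := by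
  refine (fromRel_adj _ _ _).mpr ⟨fun hpv => ?_, .inr h⟩
  exact (E.rank_lt_of_mem_pred (mem_pred_of_mem_parent h)).ne
    (congrArg E.rank (Option.some_injective _ hpv))

open Classical in
/-- The bag at a vertex consists of the vertex and its predecessors. -/
noncomputable def decompositionBag : Option V → Finset V
  | none => ∅
  | some v => insert v (E.pred v)

theorem mem_decompositionBag_some {u v : V} :
    u ∈ E.decompositionBag (some v) ↔ u = v ∨ u ∈ E.pred v := by
  simp [decompositionBag]

theorem card_decompositionBag_le (x : Option V) : (E.decompositionBag x).card ≤ w := by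
  cases x with
  | none => simp [decompositionBag]
  | some v =>
    classical
    rw [decompositionBag]
    exact (Finset.card_insert_le _ _).trans (E.card_pred_lt v)

theorem connected_induce_decompositionTree (v : V) :
    (E.decompositionTree.induce {x | v ∈ E.decompositionBag x}).Connected := by
  have hv : v ∈ E.decompositionBag (some v) := E.mem_decompositionBag_some.mpr (.inl rfl)
  have reachable : ∀ u (hu : v ∈ E.decompositionBag (some u)),
      (E.decompositionTree.induce {x | v ∈ E.decompositionBag x}).Reachable
        ⟨some v, hv⟩ ⟨some u, hu⟩ := fun u hu => by
    induction hn : E.rank u using Nat.strong_induction_on generalizing u with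
    | _ n ih =>
      rcases E.mem_decompositionBag_some.mp hu with rfl | hvu
      · exact .rfl
      obtain ⟨p, hp, hvp⟩ := E.exists_mem_parent_of_mem_pred hvu
      have hlt := E.rank_lt_of_mem_pred (mem_pred_of_mem_parent hp)
      exact (ih _ (hn ▸ hlt) p (E.mem_decompositionBag_some.mpr hvp) rfl).trans
        (Adj.reachable (E.decompositionTree_adj hp))
  refine (connected_iff_exists_forall_reachable _).mpr ⟨⟨some v, hv⟩, ?_⟩
  rintro ⟨_ | u, hu⟩
  · simp [decompositionBag] at hu
  · exact reachable u hu

/-- The tree-decomposition given by an elimination scheme. -/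
noncomputable def treeDecomposition [Finite V] : TreeDecomposition G E.decompositionTree where
  isTree := E.decompositionTree_isTree
  bag := E.decompositionBag
  edge_mem u v h := by
    rcases E.mem_pred_or_mem_pred_of_adj h with h | h
    · exact ⟨some v, E.mem_decompositionBag_some.mpr (.inr h),
        E.mem_decompositionBag_some.mpr (.inl rfl)⟩
    · exact ⟨some u, E.mem_decompositionBag_some.mpr (.inl rfl),
        E.mem_decompositionBag_some.mpr (.inr h)⟩
  connected := E.connected_induce_decompositionTree

end TreeDecomposition

section Coloring

variable {V : Type*} {G : SimpleGraph V} {w : ℕ}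

/-- Greedy choice in order of rank. The states in `σ` stand for the choices made so far, and
`color s v` is the colour that `v` receives in the state `s`. -/
theorem exists_forall_adj_color_ne [Finite V] (E : EliminationScheme G w) {σ C : Type*}
    [Nonempty σ] (color : σ → V → C)
    (extend : ∀ s v, ∃ s', (∀ u ≠ v, E.rank u ≤ E.rank v → color s' u = color s u) ∧
      ∀ u ∈ E.pred v, G.Adj u v → color s' u ≠ color s' v) :
    ∃ s, ∀ ⦃u v⦄, G.Adj u v → color s u ≠ color s v := by
  classical
  suffices h : ∀ S : Finset V, ∃ s, ∀ u ∈ S, ∀ v ∈ S, G.Adj u v → color s u ≠ color s v by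
    have := Fintype.ofFinite V
    obtain ⟨s, hs⟩ := h Finset.univ
    exact ⟨s, fun u v => hs u (Finset.mem_univ u) v (Finset.mem_univ v)⟩
  intro S
  induction S using Finset.induction_on_max_value E.rank with
  | empty => exact ⟨Classical.arbitrary σ, by simp⟩
  | insert v S hvS hmax ih =>
    obtain ⟨s, hs⟩ := ih
    obtain ⟨s', hkeep, hnew⟩ := extend s v
    have color_eq : ∀ u ∈ S, color s' u = color s u := fun u hu =>
      hkeep u (ne_of_mem_of_not_mem hu hvS) (hmax u hu)
    have color_ne : ∀ u ∈ S, G.Adj u v → color s' u ≠ color s' v := fun u hu huv =>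
      hnew u ((E.mem_pred_or_mem_pred_of_adj huv).resolve_right fun hvu =>
        (E.rank_lt_of_mem_pred hvu).not_ge (hmax u hu)) huv
    refine ⟨s', fun x hx y hy hxy => ?_⟩
    rcases Finset.mem_insert.mp hx with rfl | hxS <;> rcases Finset.mem_insert.mp hy with rfl | hyS
    · exact (hxy.ne rfl).elim
    · exact (color_ne y hyS hxy.symm).symm
    · exact color_ne x hxS hxy
    · rw [color_eq x hxS, color_eq y hyS]
      exact hs x hxS y hyS hxy

theorem colorable [Finite V] (E : EliminationScheme G w) : G.Colorable w := by
  classical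
  have : Nonempty (V → Fin w) := ⟨fun v => ⟨0, Nat.zero_lt_of_lt (E.card_pred_lt v)⟩⟩
  obtain ⟨f, hf⟩ := E.exists_forall_adj_color_ne (fun f : V → Fin w => f) fun f v => by
    have hcard : ((E.pred v).image f).card < (Finset.univ : Finset (Fin w)).card := by
      simpa using Finset.card_image_le.trans_lt (E.card_pred_lt v)
    obtain ⟨i, -, hi⟩ := Finset.exists_mem_notMem_of_card_lt_card hcard
    refine ⟨Function.update f v i, fun u huv _ => Function.update_of_ne huv i f,
      fun u hu huv => ?_⟩
    rw [Function.update_of_ne huv.ne, Function.update_self]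
    exact fun h => hi (h ▸ Finset.mem_image_of_mem f hu)
  exact ⟨Coloring.mk f fun {_ _} huv => hf huv⟩

end Coloring

/-- The elimination scheme induced on a graph that maps injectively to `G`. -/
noncomputable def comap {V V' : Type*} {G : SimpleGraph V} {G' : SimpleGraph V'} {w : ℕ}
    (E : EliminationScheme G w) (f : G' →g G) (hf : Function.Injective f) :
    EliminationScheme G' w where
  rank v := E.rank (f v)
  pred v := (E.pred (f v)).preimage f hf.injOn
  rank_lt_of_mem_pred h := E.rank_lt_of_mem_pred (Finset.mem_preimage.mp h)
  card_pred_lt v := (Finset.card_le_card_of_injOn f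
    (fun _ hu => Finset.mem_preimage.mp hu) hf.injOn).trans_lt (E.card_pred_lt (f v))
  mem_pred_or_mem_pred_of_adj h := by
    simpa only [Finset.mem_preimage] using E.mem_pred_or_mem_pred_of_adj (f.map_adj h)
  mem_pred_or_mem_pred_of_mem_pred hu hu' h := by
    simp only [Finset.mem_preimage] at hu hu' ⊢
    exact E.mem_pred_or_mem_pred_of_mem_pred hu hu' (hf.ne h)

end EliminationScheme

section Treewidth

theorem TreeDecomposition.width_lt_iff {V : Type} {G : SimpleGraph V} {ι : Type} [Fintype ι]
    {T : SimpleGraph ι} (D : TreeDecomposition G T) {w : ℕ} :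
    D.width < w ↔ ∀ x, (D.bag x).card ≤ w := by
  rw [width, sub_lt_iff_lt_add, Int.lt_add_one_iff, Nat.cast_le, Finset.sup_le_iff]
  simp only [Finset.mem_univ, true_imp_iff]

theorem TreeDecomposition.neg_one_le_width {V : Type} {G : SimpleGraph V} {ι : Type} [Fintype ι]
    {T : SimpleGraph ι} (D : TreeDecomposition G T) : -1 ≤ D.width := by
  rw [width]
  lia

theorem nonempty_setOf_width {V : Type} [Finite V] (G : SimpleGraph V) :
    {w : ℤ | ∃ (ι : Type) (_ : Fintype ι) (T : SimpleGraph ι) (D : TreeDecomposition G T),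
      D.width = w}.Nonempty := by
  have := Fintype.ofFinite V
  let D : TreeDecomposition G (⊥ : SimpleGraph Unit) :=
    { isTree := IsTree.of_subsingleton
      bag := fun _ => Finset.univ
      edge_mem := fun u v _ => ⟨(), Finset.mem_univ u, Finset.mem_univ v⟩
      connected := fun v => by
        have : Nonempty {_x : Unit | v ∈ (Finset.univ : Finset V)} := ⟨(), Finset.mem_univ v⟩
        exact IsTree.of_subsingleton.connected }
  exact ⟨D.width, Unit, inferInstance, ⊥, D, rfl⟩

theorem neg_one_le_treewidth (G : FiniteGraph) : -1 ≤ treewidth G := by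
  have := G.fintypeV
  refine le_csInf (nonempty_setOf_width G.graph) ?_
  rintro _ ⟨ι, _, T, D, rfl⟩
  exact D.neg_one_le_width

theorem treewidth_lt_iff {G : FiniteGraph} {w : ℕ} :
    treewidth G < w ↔ Nonempty (EliminationScheme G.graph w) := by
  have := G.fintypeV
  have hbdd : BddBelow {w : ℤ | ∃ (ι : Type) (_ : Fintype ι) (T : SimpleGraph ι)
      (D : TreeDecomposition G.graph T), D.width = w} :=
    ⟨-1, by rintro _ ⟨ι, _, T, D, rfl⟩; exact D.neg_one_le_width⟩
  rw [treewidth, csInf_lt_iff hbdd (nonempty_setOf_width G.graph)]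
  constructor
  · rintro ⟨_, ⟨ι, _, T, D, rfl⟩, hD⟩
    exact D.nonempty_eliminationScheme (D.width_lt_iff.mp hD)
  · rintro ⟨E⟩
    exact ⟨_, ⟨Option G.V, inferInstance, _, E.treeDecomposition, rfl⟩,
      E.treeDecomposition.width_lt_iff.mpr E.card_decompositionBag_le⟩

theorem exists_treewidth_add_one_eq (G : FiniteGraph) :
    ∃ w : ℕ, treewidth G + 1 = w ∧ Nonempty (EliminationScheme G.graph w) := by
  have hnonneg : 0 ≤ treewidth G + 1 := by linarith [neg_one_le_treewidth G]
  obtain ⟨w, hw⟩ := Int.eq_ofNat_of_zero_le hnonneg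
  exact ⟨w, hw, treewidth_lt_iff.mp (by lia)⟩

theorem treewidth_le_of_injective_hom {G H : FiniteGraph} (f : G.graph →g H.graph)
    (hf : Function.Injective f) : treewidth G ≤ treewidth H := by
  obtain ⟨w, hw, ⟨E⟩⟩ := exists_treewidth_add_one_eq H
  have hlt : treewidth G < w := treewidth_lt_iff.mpr ⟨E.comap f hf⟩
  lia

theorem colorable_of_treewidth_le {G : FiniteGraph} {k : ℕ} (h : treewidth G ≤ k) :
    G.graph.Colorable (k + 1) := by
  have := G.fintypeV
  obtain ⟨E⟩ := treewidth_lt_iff.mp (Int.lt_add_one_iff.mpr h)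
  exact E.colorable

end Treewidth

section DefectAndClustering

variable {V : Type} {G : SimpleGraph V} {c : ℕ} {f : V → Fin c}

theorem HasDefect.ncard_monochromatic_neighbors_le {d : ℕ} (h : HasDefect G f d) (v : V) :
    {u | G.Adj v u ∧ f u = f v}.ncard ≤ d := by
  let H := G.induce {u | f u = f v}
  let C := H.connectedComponentMk ⟨v, rfl⟩
  let v' : C := ⟨⟨v, rfl⟩, rfl⟩
  have hinj : Function.Injective fun x : C => (x.1.1 : V) :=
    Subtype.val_injective.comp Subtype.val_injective
  have himage : {u | G.Adj v u ∧ f u = f v} =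
      (fun x : C => (x.1.1 : V)) '' C.toSimpleGraph.neighborSet v' := by
    ext u
    constructor
    · rintro ⟨hvu, hu⟩
      have hvu' : H.Adj ⟨v, rfl⟩ ⟨u, hu⟩ := hvu
      exact ⟨⟨⟨u, hu⟩, ConnectedComponent.sound hvu'.symm.reachable⟩, hvu', rfl⟩
    · rintro ⟨x, hvx, rfl⟩
      exact ⟨hvx, x.1.2⟩
  rw [himage, Set.ncard_image_of_injective _ hinj]
  exact h (f v) C v'

theorem HasClustering.hasDefect [Finite V] {m : ℕ} (h : HasClustering G f m) :
    HasDefect G f m := fun i C v =>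
  calc (C.toSimpleGraph.neighborSet v).ncard
      ≤ Nat.card C := Set.ncard_le_card _
    _ ≤ m := h i C

theorem HasClustering.of_coloring (f : G.Coloring (Fin c)) : HasClustering G f 1 := by
  intro i C
  have hbot : G.induce {v | f v = i} = ⊥ := by
    ext u v
    exact iff_of_false (fun huv => f.valid huv (u.2.trans v.2.symm)) id
  have hsubsingleton : C.supp.Subsingleton := fun x hx y hy =>
    reachable_bot.mp (hbot ▸ C.reachable_of_mem_supp hx hy)
  have := hsubsingleton.finite.to_subtype
  exact Set.ncard_le_one_iff_subsingleton.mpr hsubsingleton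

end DefectAndClustering

namespace EliminationScheme

section Blowup

variable {V : Type*} {G : SimpleGraph V} {w : ℕ} (E : EliminationScheme G w)
variable (A : Type*) [Zero A]

/-- The vertices up to `v`. Others of the same rank as `v` are left out, so that the choices at
such vertices are independent. -/
def initialSegment (v : V) : Set V :=
  {u | u = v ∨ E.rank u < E.rank v}

variable {E} in
theorem initialSegment_subset {u v : V} (h : u ∈ E.pred v) :
    E.initialSegment u ⊆ E.initialSegment v := by
  rintro x (rfl | hx)
  · exact .inr (E.rank_lt_of_mem_pred h)
  · exact .inr (hx.trans (E.rank_lt_of_mem_pred h))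

/-- A vertex of the blow-up of `G`: a copy of the vertex `base`, given by the sequence of choices
in `A` made at the vertices up to `base`. The sequence is extended by zero to all of `V`. -/
@[ext]
structure BlowupVertex where
  base : V
  choice : V → A
  support_subset : Function.support choice ⊆ E.initialSegment base

instance [Finite V] [Finite A] : Finite (E.BlowupVertex A) :=
  .of_injective (fun x => (x.base, x.choice)) fun _ _ h =>
    BlowupVertex.ext (congrArg Prod.fst h) (congrArg Prod.snd h)

variable {A}

/-- The copy of `v` reached by the choices `a`. -/
noncomputable def copy (v : V) (a : V → A) : E.BlowupVertex A where
  base := v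
  choice := (E.initialSegment v).indicator a
  support_subset := Set.support_indicator_subset

variable {E} in
theorem copy_choice_copy {u v : V} (h : u ∈ E.pred v) (a : V → A) :
    E.copy u (E.copy v a).choice = E.copy u a := by
  refine BlowupVertex.ext rfl ?_
  simp only [copy, Set.indicator_indicator, Set.inter_eq_left.mpr (initialSegment_subset h)]

open Classical in
theorem copy_update_of_ne {u v : V} (huv : u ≠ v) (h : E.rank u ≤ E.rank v) (a : V → A) (t : A) :
    E.copy u (Function.update a v t) = E.copy u a := by
  refine BlowupVertex.ext rfl (Set.indicator_congr ?_)
  rintro x (rfl | hx)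
  · exact Function.update_of_ne huv t a
  · exact Function.update_of_ne (fun hxv => (hx.trans_le h).ne (congrArg E.rank hxv)) t a

open Classical in
theorem copy_update_injective (v : V) (a : V → A) :
    Function.Injective fun t => E.copy v (Function.update a v t) := fun t t' h => by
  have hv : v ∈ E.initialSegment v := .inl rfl
  simpa only [copy, Set.indicator_of_mem hv, Function.update_self] using
    congrFun (congrArg BlowupVertex.choice h) v

open Classical in
/-- The copies of the predecessors of `x.base` reached by the choices leading to `x`. -/
noncomputable def blowupPred (x : E.BlowupVertex A) : Finset (E.BlowupVertex A) :=
  (E.pred x.base).image fun u => E.copy u x.choice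

theorem mem_blowupPred {x y : E.BlowupVertex A} :
    x ∈ E.blowupPred y ↔ ∃ u ∈ E.pred y.base, E.copy u y.choice = x := by
  simp only [blowupPred, Finset.mem_image]

variable {E} in
theorem copy_mem_blowupPred_copy {u v : V} (h : u ∈ E.pred v) (a : V → A) :
    E.copy u a ∈ E.blowupPred (E.copy v a) :=
  E.mem_blowupPred.mpr ⟨u, h, copy_choice_copy h a⟩

variable (A) in
/-- The tree-like blow-up of `G`, in which each choice of copies of the vertices before `v` extends
to one copy of `v` for every element of `A`. -/
def blowup : SimpleGraph (E.BlowupVertex A) where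
  Adj x y := G.Adj x.base y.base ∧ (x ∈ E.blowupPred y ∨ y ∈ E.blowupPred x)
  symm := ⟨fun _ _ h => ⟨h.1.symm, h.2.symm⟩⟩
  loopless := ⟨fun _ h => h.1.ne rfl⟩

theorem blowup_adj_copy_copy {u v : V} (h : G.Adj u v) (a : V → A) :
    (E.blowup A).Adj (E.copy u a) (E.copy v a) :=
  ⟨h, (E.mem_pred_or_mem_pred_of_adj h).imp
    (copy_mem_blowupPred_copy · a) (copy_mem_blowupPred_copy · a)⟩

variable (A) in
/-- The projection of the blow-up to `G`. -/
def blowupHom : E.blowup A →g G where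
  toFun := BlowupVertex.base
  map_rel' h := h.1

/-- The copy of `G` in its blow-up given by the choices `a`. -/
noncomputable def copyHom (a : V → A) : G →g E.blowup A where
  toFun v := E.copy v a
  map_rel' h := E.blowup_adj_copy_copy h a

theorem copyHom_injective (a : V → A) : Function.Injective (E.copyHom a) :=
  fun _ _ h => congrArg BlowupVertex.base h

variable (A) in
/-- The elimination scheme of the blow-up, with the ranks of `G`. -/
noncomputable def blowupScheme : EliminationScheme (E.blowup A) w where
  rank x := E.rank x.base
  pred := E.blowupPred
  rank_lt_of_mem_pred h := by
    obtain ⟨u, hu, rfl⟩ := E.mem_blowupPred.mp h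
    exact E.rank_lt_of_mem_pred hu
  card_pred_lt x := by
    classical
    exact Finset.card_image_le.trans_lt (E.card_pred_lt x.base)
  mem_pred_or_mem_pred_of_adj h := h.2
  mem_pred_or_mem_pred_of_mem_pred {x x' y} hx hx' hne := by
    obtain ⟨u, hu, rfl⟩ := E.mem_blowupPred.mp hx
    obtain ⟨u', hu', rfl⟩ := E.mem_blowupPred.mp hx'
    have huu' : u ≠ u' := fun h => hne (h ▸ rfl)
    exact (E.mem_pred_or_mem_pred_of_mem_pred hu hu' huu').imp
      (copy_mem_blowupPred_copy · _) (copy_mem_blowupPred_copy · _)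

end Blowup

section BlowupColoring

variable {V : Type} [Finite V] {G : SimpleGraph V} {w : ℕ} (E : EliminationScheme G w)
variable {A : Type} [Zero A] [Fintype A] {c d : ℕ} {f : E.BlowupVertex A → Fin c}

open Classical in
theorem card_filter_copy_update_eq_le (hf : HasDefect (E.blowup A) f d) {u v : V}
    (hu : u ∈ E.pred v) (huv : G.Adj u v) (a : V → A) :
    Finset.card {t | f (E.copy v (Function.update a v t)) = f (E.copy u a)} ≤ d := by
  rw [← Finset.card_image_of_injective _ (E.copy_update_injective v a), ← Set.ncard_coe_finset]
  refine (Set.ncard_le_ncard ?_).trans (hf.ncard_monochromatic_neighbors_le (E.copy u a))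
  intro x hx
  obtain ⟨t, ht, rfl⟩ := Finset.mem_image.mp (Finset.mem_coe.mp hx)
  refine ⟨?_, (Finset.mem_filter.mp ht).2⟩
  rw [← E.copy_update_of_ne huv.ne (E.rank_lt_of_mem_pred hu).le a t]
  exact E.blowup_adj_copy_copy huv _

open Classical in
theorem exists_forall_mem_pred_copy_update_ne (hf : HasDefect (E.blowup A) f d)
    (hA : w * d < Fintype.card A) (a : V → A) (v : V) :
    ∃ t, ∀ u ∈ E.pred v, G.Adj u v → f (E.copy v (Function.update a v t)) ≠ f (E.copy u a) := by
  let excluded (u : V) : Finset A := {t | f (E.copy v (Function.update a v t)) = f (E.copy u a)}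
  let S : Finset V := {u ∈ E.pred v | G.Adj u v}
  have hcard : (S.biUnion excluded).card < (Finset.univ : Finset A).card :=
    calc (S.biUnion excluded).card ≤ S.card * d :=
          Finset.card_biUnion_le_card_mul S excluded d fun u hu =>
            E.card_filter_copy_update_eq_le hf (Finset.mem_filter.mp hu).1
              (Finset.mem_filter.mp hu).2 a
      _ ≤ w * d := by
          gcongr
          exact (Finset.card_filter_le _ _).trans (E.card_pred_lt v).le
      _ < (Finset.univ : Finset A).card := hA
  obtain ⟨t, -, ht⟩ := Finset.exists_mem_notMem_of_card_lt_card hcard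
  exact ⟨t, fun u hu huv heq => ht (Finset.mem_biUnion.mpr
    ⟨u, Finset.mem_filter.mpr ⟨hu, huv⟩, Finset.mem_filter.mpr ⟨Finset.mem_univ t, heq⟩⟩)⟩

theorem colorable_of_hasDefect_blowup (hf : HasDefect (E.blowup A) f d)
    (hA : w * d < Fintype.card A) : G.Colorable c := by
  classical
  obtain ⟨a, ha⟩ := E.exists_forall_adj_color_ne (fun (a : V → A) v => f (E.copy v a))
    fun a v => by
      obtain ⟨t, ht⟩ := E.exists_forall_mem_pred_copy_update_ne hf hA a v
      refine ⟨Function.update a v t, fun u huv h => ?_, fun u hu huv => ?_⟩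
      · rw [E.copy_update_of_ne huv h]
      · rw [E.copy_update_of_ne huv.ne (E.rank_lt_of_mem_pred hu).le]
        exact (ht u hu huv).symm
  exact ⟨Coloring.mk (fun v => f (E.copy v a)) fun {_ _} huv => ha huv⟩

end BlowupColoring

end EliminationScheme

theorem exists_hom_treewidth_eq_colorable_of_hasDefect (G : FiniteGraph) (d : ℕ) :
    ∃ H : FiniteGraph, treewidth H = treewidth G ∧ Nonempty (H.graph →g G.graph) ∧
      ∀ {c : ℕ} {f : H.V → Fin c}, HasDefect H.graph f d → G.graph.Colorable c := by
  have := G.fintypeV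
  obtain ⟨w, hw, ⟨E⟩⟩ := exists_treewidth_add_one_eq G
  let A := Fin (w * d + 1)
  let H : FiniteGraph := ⟨E.BlowupVertex A, Fintype.ofFinite _, E.blowup A⟩
  have hle : treewidth G ≤ treewidth H :=
    treewidth_le_of_injective_hom (H := H) (E.copyHom 0) (E.copyHom_injective 0)
  have hlt : treewidth H < w := treewidth_lt_iff.mpr ⟨E.blowupScheme A⟩
  exact ⟨H, by lia, ⟨E.blowupHom A⟩, fun hf => E.colorable_of_hasDefect_blowup hf (by simp [A])⟩

section ChromaticNumbers

variable {𝒢 : Set FiniteGraph}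

theorem classChromaticNumber_le_of_treewidth_le {k : ℕ} (h : ∀ G ∈ 𝒢, treewidth G ≤ k) :
    classChromaticNumber 𝒢 ≤ (k + 1 : ℕ) :=
  iSup₂_le fun G hG =>
    chromaticNumber_le_iff_colorable.mpr (colorable_of_treewidth_le (h G hG))

theorem classChromaticNumber_ne_top_of_treewidth_le {k : ℕ} (h : ∀ G ∈ 𝒢, treewidth G ≤ k) :
    classChromaticNumber 𝒢 ≠ ⊤ :=
  ne_top_of_le_ne_top (ENat.natCast_ne_top (k + 1)) (classChromaticNumber_le_of_treewidth_le h)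

variable (𝒢) in
theorem defectiveChromaticNumber_le_clusteredChromaticNumber :
    defectiveChromaticNumber 𝒢 ≤ clusteredChromaticNumber 𝒢 :=
  le_iInf₂ fun c ⟨m, hm⟩ => iInf₂_le c ⟨m, fun G hG => by
    have := G.fintypeV
    obtain ⟨f, hf⟩ := hm G hG
    exact ⟨f, hf.hasDefect⟩⟩

variable (𝒢) in
theorem clusteredChromaticNumber_le_classChromaticNumber :
    clusteredChromaticNumber 𝒢 ≤ classChromaticNumber 𝒢 := by
  cases hc : classChromaticNumber 𝒢 with
  | top => exact le_top
  | coe c =>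
    refine iInf₂_le c ⟨1, fun G hG => ?_⟩
    have hle : G.graph.chromaticNumber ≤ c :=
      hc ▸ le_iSup₂ (f := fun (G : FiniteGraph) (_ : G ∈ 𝒢) => G.graph.chromaticNumber) G hG
    obtain ⟨f⟩ := chromaticNumber_le_iff_colorable.mp hle
    exact ⟨f, .of_coloring f⟩

theorem classChromaticNumber_le_defectiveChromaticNumber
    (hclosed : ∀ G ∈ 𝒢, ∀ H : FiniteGraph, treewidth H = treewidth G →
      Nonempty (H.graph →g G.graph) → H ∈ 𝒢) :
    classChromaticNumber 𝒢 ≤ defectiveChromaticNumber 𝒢 :=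
  le_iInf₂ fun c ⟨d, hd⟩ => iSup₂_le fun G hG => by
    obtain ⟨H, htw, hhom, hcolorable⟩ := exists_hom_treewidth_eq_colorable_of_hasDefect G d
    obtain ⟨f, hf⟩ := hd H (hclosed G hG H htw hhom)
    exact chromaticNumber_le_iff_colorable.mpr (hcolorable hf)

theorem mainTheorem1_general
    (hclosed : ∀ G ∈ 𝒢, ∀ H : FiniteGraph, treewidth H = treewidth G →
      Nonempty (H.graph →g G.graph) → H ∈ 𝒢) :
    defectiveChromaticNumber 𝒢 = clusteredChromaticNumber 𝒢 ∧
      clusteredChromaticNumber 𝒢 = classChromaticNumber 𝒢 := by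
  have hdc := defectiveChromaticNumber_le_clusteredChromaticNumber 𝒢
  have hcχ := clusteredChromaticNumber_le_classChromaticNumber 𝒢
  have hχd := classChromaticNumber_le_defectiveChromaticNumber hclosed
  exact ⟨hdc.antisymm (hcχ.trans hχd), hcχ.antisymm (hχd.trans hdc)⟩

end ChromaticNumbers

theorem cliqueFree_of_hom {V W : Type*} {G : SimpleGraph V} {H : SimpleGraph W} {n : ℕ}
    (f : H →g G) (h : G.CliqueFree n) : H.CliqueFree n := by
  contrapose! h
  rw [not_cliqueFree_iff_top_isContained] at h ⊢
  obtain ⟨g⟩ := h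
  exact ⟨⟨f.comp g.toHom, Hom.injective_of_top_hom _⟩⟩

theorem mainTheorem1 (p k : ℕ) (hp : 3 ≤ p) (hk : 1 ≤ k) :
    (defectiveChromaticNumber (cliqueFreeTreewidthEq p k) =
        clusteredChromaticNumber (cliqueFreeTreewidthEq p k) ∧
      clusteredChromaticNumber (cliqueFreeTreewidthEq p k) =
        classChromaticNumber (cliqueFreeTreewidthEq p k) ∧
      classChromaticNumber (cliqueFreeTreewidthEq p k) ≠ ⊤) ∧
    (defectiveChromaticNumber (cliqueFreeTreewidthLE p k) =
        clusteredChromaticNumber (cliqueFreeTreewidthLE p k) ∧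
      clusteredChromaticNumber (cliqueFreeTreewidthLE p k) =
        classChromaticNumber (cliqueFreeTreewidthLE p k) ∧
      classChromaticNumber (cliqueFreeTreewidthLE p k) ≠ ⊤) := by
  have hEq := mainTheorem1_general (𝒢 := cliqueFreeTreewidthEq p k)
    fun _ hG _ htw ⟨f⟩ => ⟨cliqueFree_of_hom f hG.1, htw.trans hG.2⟩
  have hLE := mainTheorem1_general (𝒢 := cliqueFreeTreewidthLE p k)
    fun _ hG _ htw ⟨f⟩ => ⟨cliqueFree_of_hom f hG.1, htw.le.trans hG.2⟩
  exact ⟨⟨hEq.1, hEq.2, classChromaticNumber_ne_top_of_treewidth_le fun _ hG => hG.2.le⟩,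
    hLE.1, hLE.2, classChromaticNumber_ne_top_of_treewidth_le fun _ hG => hG.2⟩
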